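/- Let $2^\omega$ be the Cantor space with its product topology and its product (Lebesgue) probability measure. Let $\operatorname{cov}(\mathcal N)$ be the least cardinality of a family of Lebesgue null subsets of $2^\omega$ covering $2^\omega$, let $\mathfrak b$ be the least cardinality of a subset of $\omega^\omega$ that is unbounded with respect to eventual domination, and let $\mathfrak c=2^{\aleph_0}$. A perfect set is a homeomorphic copy of $2^\omega$. A set $X\subseteq 2^\omega$ is - totally imperfect if it contains no perfect set; - Hurewicz if for every sequence $\mathcal U_0,\mathcal U_1,\dots$ of open covers of $X$ there are finite sets $\mathcal F_n\subseteq\mathcal U_n$ such that every $x\in X$ belongs to $\bigcup\mathcal F_n$ for all but finitely many $n$; - countably perfectly meager if for every sequence $(P_n)_{n\in\omega}$ of perfect subsets of $2^\omega$ there is an $F_\sigma$-set $F\supseteq X$ such that $P_n\cap F$ is meager in $P_n$ for every $n$; - everywhere meager if for every infinite $a\subseteq\omega$ the set $\{x{\restriction}a : x\in X\}$ is meager in $2^a$. Assume that $\operatorname{cov}(\mathcal N)=\mathfrak b=\mathfrak c$. Then there is a set $X\subseteq 2^\omega$ that is totally imperfect and Hurewicz (and hence countably perfectly meager) but not everywhere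 meager. In particular, under this hypothesis not every countably perfectly meager subset of $2^\omega$ is everywhere meager. -/

import Mathlib

open MeasureTheory Set Filter Topology

noncomputable section

/-- The Cantor space `2^ω`, with the product topology. -/
abbrev CantorSpace : Type := ℕ → Bool

/-- The fair coin measure on `{0,1}`. -/
def coinMeasure : Measure Bool := (PMF.uniformOfFintype Bool).toMeasure

instance : IsProbabilityMeasure coinMeasure := by
  unfold coinMeasure; infer_instance

/-- The Lebesgue measure on `2^ω`: the product of countably many fair coin measures. -/
def cantorMeasure : Measure CantorSpace := Measure.infinitePi (fun _ : ℕ => coinMeasure)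

/-- `cov(N)`: the least cardinality of a family of Lebesgue null subsets of `2^ω`
that covers `2^ω`. -/
def covNull : Cardinal.{0} :=
  sInf {κ | ∃ 𝒜 : Set (Set CantorSpace),
    (∀ A ∈ 𝒜, cantorMeasure A = 0) ∧ ⋃₀ 𝒜 = univ ∧ Cardinal.mk 𝒜 = κ}

/-- The bounding number `𝔟`: the least cardinality of a subset of `ω^ω` which is
unbounded with respect to eventual domination. -/
def boundingNumber : Cardinal.{0} :=
  sInf {κ | ∃ B : Set (ℕ → ℕ),
    (¬ ∃ g : ℕ → ℕ, ∀ f ∈ B, ∀ᶠ n in atTop, f n ≤ g n) ∧ Cardinal.mk B = κ}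

/-- `𝒰` is a cover of `X` by open sets of the ambient space. -/
def IsOpenCoverOf {α : Type*} [TopologicalSpace α] (𝒰 : Set (Set α)) (X : Set α) : Prop :=
  (∀ U ∈ 𝒰, IsOpen U) ∧ X ⊆ ⋃₀ 𝒰

/-- The Hurewicz covering property: from every sequence of open covers of `X` one can choose
finite subfamilies such that every point of `X` belongs to the unions of all but finitely many
of them. -/
def IsHurewicz {α : Type*} [TopologicalSpace α] (X : Set α) : Prop :=
  ∀ 𝒰 : ℕ → Set (Set α), (∀ n, IsOpenCoverOf (𝒰 n) X) →
    ∃ ℱ : ℕ → Set (Set α), (∀ n, ℱ n ⊆ 𝒰 n ∧ (ℱ n).Finite) ∧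
      ∀ x ∈ X, ∀ᶠ n in atTop, x ∈ ⋃₀ (ℱ n)

/-- A perfect set, i.e. a homeomorphic copy of the Cantor space. -/
def IsCantorCopy {α : Type*} [TopologicalSpace α] (P : Set α) : Prop :=
  Nonempty (P ≃ₜ CantorSpace)

/-- `X` contains no perfect set. -/
def IsTotallyImperfect {α : Type*} [TopologicalSpace α] (X : Set α) : Prop :=
  ∀ P : Set α, IsCantorCopy P → ¬ P ⊆ X

/-- `F` is a countable union of closed sets. -/
def IsFSigmaSet {α : Type*} [TopologicalSpace α] (F : Set α) : Prop :=
  ∃ C : ℕ → Set α, (∀ n, IsClosed (C n)) ∧ F = ⋃ n, C n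

/-- `X` is countably perfectly meager: for every sequence of perfect sets `P n` there is an
`F_σ`-set `F ⊇ X` such that each `P n ∩ F` is meager in the relative topology of `P n`. -/
def IsCountablyPerfectlyMeager (X : Set CantorSpace) : Prop :=
  ∀ P : ℕ → Set CantorSpace, (∀ n, IsCantorCopy (P n)) →
    ∃ F : Set CantorSpace, IsFSigmaSet F ∧ X ⊆ F ∧
      ∀ n, IsMeagre ((Subtype.val : P n → CantorSpace) ⁻¹' F)

/-- `X` is everywhere meager: for every infinite `a ⊆ ω` the set `{x ↾ a : x ∈ X}` is meager
in `2^a`. -/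
def IsEverywhereMeager (X : Set CantorSpace) : Prop :=
  ∀ a : Set ℕ, a.Infinite →
    IsMeagre ((fun (x : CantorSpace) (i : a) => x i) '' X : Set (a → Bool))

end

/-! View `2^ω` as a product, with even coordinates `y` and odd coordinates `z`. The set X is built
in `𝔠` stages, each handling a task: a point `y`, a measurable set G and a measurable set P. If P is
perfect, a point of P is reserved to stay outside X forever, so X is totally imperfect. A point of X
is chosen in the fibre over `y`, so X projects onto the even coordinates and is not everywhere
meager. It also avoids G whenever the fibre of G is not conull.

Hence a `G_δ` set containing X has all fibres conull. By compactness such a set contains a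
`σ`-compact set with conull fibres, and all points of X chosen after a stage handling it are put
there. Each choice avoids fewer than `𝔠` null sets within a set of positive measure, which `cov(N) =
𝔠` permits (`exists_interleave_mem`). So X lies in the `σ`-compact set up to fewer than `𝔠 = 𝔟`
points, which gives Hurewicz (`isHurewicz_of_concentrated`). -/

instance : IsProbabilityMeasure cantorMeasure := by
  unfold cantorMeasure; infer_instance

/-! ### Sets with conull fibres -/

/-- The point of `2^ω` with even part `y` and odd part `z`. -/
def interleave (y z : CantorSpace) : CantorSpace :=
  fun n => if n % 2 = 0 then y (n / 2) else z (n / 2)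

theorem interleave_even (y z : CantorSpace) (n : ℕ) : interleave y z (2 * n) = y n := by
  simp [interleave]

theorem interleave_odd (y z : CantorSpace) (n : ℕ) : interleave y z (2 * n + 1) = z n := by
  have : (2 * n + 1) / 2 = n := by omega
  simp [interleave, this]

theorem continuous_interleave :
    Continuous fun p : CantorSpace × CantorSpace => interleave p.1 p.2 := by
  refine continuous_pi fun n => ?_
  by_cases h : n % 2 = 0 <;> simp only [interleave, h, if_true, if_false] <;> fun_prop

theorem continuous_interleave_right (y : CantorSpace) : Continuous (interleave y) :=
  continuous_interleave.comp (Continuous.prodMk_right y)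

theorem interleave_injective_right (y : CantorSpace) : Function.Injective (interleave y) := by
  intro z z' h
  funext n
  rw [← interleave_odd y z n, h, interleave_odd]

/-- `G` has conull vertical sections. -/
def HasFullSections (G : Set CantorSpace) : Prop :=
  ∀ y, cantorMeasure (interleave y ⁻¹' G)ᶜ = 0

/-- A large compact subset of one fibre stays inside `U` over a whole neighbourhood of `y` by the
tube lemma; finitely many such neighbourhoods cover the base, so one `ε` serves all fibres. -/
theorem exists_isCompact_subset_of_hasFullSections {U : Set CantorSpace} (hU : IsOpen U)
    (h : HasFullSections U) {ε : ENNReal} (hε : 0 < ε) :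
    ∃ C ⊆ U, IsCompact C ∧ ∀ y, cantorMeasure (interleave y ⁻¹' C)ᶜ ≤ ε := by
  have key : ∀ y : CantorSpace, ∃ V K : Set CantorSpace, V ∈ 𝓝 y ∧ IsCompact V ∧ IsCompact K ∧
      (∀ y' ∈ V, ∀ z ∈ K, interleave y' z ∈ U) ∧ cantorMeasure Kᶜ ≤ ε := by
    intro y
    have hUy : IsOpen (interleave y ⁻¹' U) := hU.preimage (continuous_interleave_right y)
    have hc : cantorMeasure (interleave y ⁻¹' U)ᶜ < ε := by rw [h y]; exact hε
    obtain ⟨W, hWU, hWo, hW⟩ := (interleave y ⁻¹' U)ᶜ.exists_isOpen_lt_of_lt ε hc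
    have hK : IsCompact Wᶜ := hWo.isClosed_compl.isCompact
    have hprod : IsOpen ((fun p : CantorSpace × CantorSpace => interleave p.1 p.2) ⁻¹' U) :=
      hU.preimage continuous_interleave
    obtain ⟨A, B, hA, -, hyA, hKB, hAB⟩ :=
      generalized_tube_lemma (isCompact_singleton (x := y)) hK hprod (by
        rintro ⟨a, b⟩ ⟨rfl, hb⟩
        by_contra hab
        exact hb (hWU hab))
    obtain ⟨V, hV, hVA, hVc⟩ := local_compact_nhds (hA.mem_nhds (hyA rfl))
    exact ⟨V, Wᶜ, hV, hVc, hK, fun y' hy' z hz => hAB (mk_mem_prod (hVA hy') (hKB hz)),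
      by rw [compl_compl]; exact hW.le⟩
  choose V K hV hVc hK hVK hKε using key
  obtain ⟨t, ht⟩ := CompactSpace.elim_nhds_subcover V hV
  refine ⟨⋃ y ∈ t, (fun p : CantorSpace × CantorSpace => interleave p.1 p.2) '' (V y ×ˢ K y),
    ?_, ?_, ?_⟩
  · simp only [iUnion_subset_iff, image_subset_iff]
    rintro y - ⟨a, b⟩ ⟨ha, hb⟩
    exact hVK y a ha b hb
  · exact t.isCompact_biUnion fun y _ => ((hVc y).prod (hK y)).image continuous_interleave
  · intro y
    have hy : y ∈ ⋃ x ∈ t, V x := ht ▸ mem_univ y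
    simp only [mem_iUnion] at hy
    obtain ⟨x, hx, hyx⟩ := hy
    refine (measure_mono (compl_subset_compl.2 fun z hz => ?_)).trans (hKε x)
    exact mem_iUnion₂.2 ⟨x, hx, ⟨(y, z), ⟨hyx, hz⟩, rfl⟩⟩

/-- A `G_δ` set with conull sections contains a `σ`-compact set with conull sections. -/
theorem exists_iUnion_isCompact_subset_of_hasFullSections {U : ℕ → Set CantorSpace}
    (hU : ∀ n, IsOpen (U n)) (h : HasFullSections (⋂ n, U n)) :
    ∃ C : ℕ → Set CantorSpace, (∀ k, IsCompact (C k)) ∧ (⋃ k, C k) ⊆ ⋂ n, U n ∧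
      HasFullSections (⋃ k, C k) := by
  have hUn : ∀ n, HasFullSections (U n) := fun n y =>
    measure_mono_null (compl_subset_compl.2 (preimage_mono (iInter_subset U n))) (h y)
  have key : ∀ k : ℕ, ∃ C ⊆ ⋂ n, U n, IsCompact C ∧
      ∀ y, cantorMeasure (interleave y ⁻¹' C)ᶜ ≤ ((k : ENNReal) + 1)⁻¹ := by
    intro k
    -- Losing `δ n` for the `n`-th open set costs less than `1/(k+1)` in total when the compact sets
    -- are intersected.
    obtain ⟨δ, hδ, hsum⟩ := ENNReal.exists_pos_sum_of_countable'
      (ε := ((k : ENNReal) + 1)⁻¹) (by simp) ℕ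
    choose C hCU hC hCδ using fun n =>
      exists_isCompact_subset_of_hasFullSections (hU n) (hUn n) (hδ n)
    refine ⟨⋂ n, C n, iInter_mono hCU,
      (hC 0).of_isClosed_subset (isClosed_iInter fun n => (hC n).isClosed) (iInter_subset _ 0),
      fun y => ?_⟩
    rw [preimage_iInter, compl_iInter]
    exact (measure_iUnion_le _).trans ((ENNReal.tsum_le_tsum fun n => hCδ n y).trans hsum.le)
  choose C hCU hC hCk using key
  refine ⟨C, hC, iUnion_subset hCU, fun y => ?_⟩
  refine le_antisymm (ge_of_tendsto' (x := atTop) (f := fun k : ℕ => ((k : ENNReal) + 1)⁻¹) ?_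
    fun k => (measure_mono (compl_subset_compl.2 (preimage_mono (subset_iUnion C k)))).trans
      (hCk k y)) zero_le
  have := (tendsto_add_atTop_iff_nat 1).2 ENNReal.tendsto_inv_nat_nhds_zero
  simpa using this

/-! ### Finite flips, the zero-one law and `cov(N)` -/

/-- Flip the coordinates of `x` in the finite set `s`. -/
def flipOn (s : Finset ℕ) (x : CantorSpace) : CantorSpace :=
  fun i => if i ∈ s then !x i else x i

theorem flipOn_flipOn (s t : Finset ℕ) (x : CantorSpace) :
    flipOn s (flipOn t x) = flipOn (symmDiff s t) x := by
  funext i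
  by_cases hs : i ∈ s <;> by_cases ht : i ∈ t <;>
    simp [flipOn, Finset.mem_symmDiff, hs, ht]

theorem flipOn_self_flipOn (s : Finset ℕ) (x : CantorSpace) : flipOn s (flipOn s x) = x := by
  rw [flipOn_flipOn, symmDiff_self]
  funext i
  simp [flipOn]

theorem coinMeasure_singleton (b : Bool) : coinMeasure {b} = 2⁻¹ := by
  simp [coinMeasure]

theorem coinMeasure_map_not : coinMeasure.map (fun b => !b) = coinMeasure := by
  refine Measure.ext_of_singleton fun b => ?_
  rw [Measure.map_apply (measurable_of_finite _) (measurableSet_singleton b)]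
  have : (fun b : Bool => !b) ⁻¹' {b} = {!b} := by
    ext a; cases a <;> cases b <;> simp
  rw [this, coinMeasure_singleton, coinMeasure_singleton]

theorem measurePreserving_flipOn (s : Finset ℕ) :
    MeasurePreserving (flipOn s) cantorMeasure cantorMeasure := by
  have hm : ∀ i : ℕ, Measurable fun b : Bool => if i ∈ s then !b else b :=
    fun i => measurable_of_finite _
  refine ⟨measurable_pi_iff.2 fun i => (hm i).comp (measurable_pi_apply i), ?_⟩
  have h := Measure.infinitePi_map_pi (fun _ : ℕ => coinMeasure) hm
  have h2 : (fun i : ℕ => coinMeasure.map fun b : Bool => if i ∈ s then !b else b)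
      = fun _ => coinMeasure := by
    funext i
    by_cases hi : i ∈ s
    · simpa [hi] using coinMeasure_map_not
    · simp [hi]
  rw [h2] at h
  exact h

theorem cantorMeasure_singleton (x : CantorSpace) : cantorMeasure {x} = 0 := by
  have h : ∀ n : ℕ, cantorMeasure {x} ≤ (2⁻¹ : ENNReal) ^ n := by
    intro n
    have : cantorMeasure ((Finset.range n : Set ℕ).pi fun i => {x i}) = (2⁻¹ : ENNReal) ^ n := by
      rw [cantorMeasure, Measure.infinitePi_pi _ fun i _ => measurableSet_singleton _]
      simp [coinMeasure_singleton]
    rw [← this]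
    refine measure_mono ?_
    rintro _ rfl i -
    rfl
  exact le_antisymm (ge_of_tendsto'
    (ENNReal.tendsto_pow_atTop_nhds_zero_of_lt_one (by simp)) h) (zero_le)

/-- Kolmogorov's zero-one law for the set of finite modifications of points of `E`. -/
theorem cantorMeasure_iUnion_flipOn {E : Set CantorSpace} (hE : MeasurableSet E)
    (h0 : cantorMeasure E ≠ 0) : cantorMeasure (⋃ s, flipOn s ⁻¹' E) = 1 := by
  set T := ⋃ s, flipOn s ⁻¹' E with hT
  have hTm : MeasurableSet T :=
    MeasurableSet.iUnion fun s => (measurePreserving_flipOn s).measurable hE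
  have hflip : ∀ s x, flipOn s x ∈ T ↔ x ∈ T := by
    have aux : ∀ s x, x ∈ T → flipOn s x ∈ T := by
      intro s x hx
      obtain ⟨t, ht⟩ := mem_iUnion.1 hx
      refine mem_iUnion.2 ⟨symmDiff t s, ?_⟩
      rw [mem_preimage, flipOn_flipOn, symmDiff_symmDiff_cancel_right]
      exact ht
    refine fun s x => ⟨fun h => ?_, aux s x⟩
    simpa only [flipOn_self_flipOn] using aux s _ h
  have hindep : ProbabilityTheory.iIndep
      (fun i : ℕ => MeasurableSpace.comap (fun x : CantorSpace => x i) inferInstance)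
      cantorMeasure :=
    ProbabilityTheory.iIndepFun_infinitePi (P := fun _ : ℕ => coinMeasure)
      (X := fun _ b => b) fun _ => measurable_id
  have htail : MeasurableSet[limsup
      (fun i : ℕ => MeasurableSpace.comap (fun x : CantorSpace => x i) inferInstance) atTop] T := by
    rw [limsup_eq_iInf_iSup_of_nat, MeasurableSpace.measurableSet_iInf]
    intro n
    -- Erasing the first `n` coordinates is a finite flip depending on `x`, so it preserves
    -- membership in `T`, yet it only reads coordinates from `n` on.
    let π : CantorSpace → CantorSpace := fun x i => if i < n then false else x i
    have hπT : π ⁻¹' T = T := by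
      ext x
      have : π x = flipOn ((Finset.range n).filter fun i => x i = true) x := by
        funext i
        by_cases hi : i < n <;> cases hx : x i <;> simp [π, flipOn, hi, hx]
      rw [mem_preimage, this, hflip]
    rw [← hπT]
    have hπ : Measurable[⨆ i ≥ n, MeasurableSpace.comap (fun x : CantorSpace => x i)
        inferInstance] π := by
      refine @measurable_pi_lambda _ _ _ (_) _ _ fun i => ?_
      by_cases hi : i < n
      · simpa only [π, hi, if_true] using @measurable_const _ _ _ (_) _
      · simp only [π, hi, if_false]
        exact (comap_measurable fun x : CantorSpace => x i).mono
          (le_iSup₂_of_le i (not_lt.1 hi) le_rfl) le_rfl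
    exact hπ hTm
  refine (ProbabilityTheory.measure_zero_or_one_of_measurableSet_limsup_atTop
    (fun i => (measurable_pi_apply i).comap_le) hindep htail).resolve_left fun hz => h0 ?_
  refine measure_mono_null (fun x hx => mem_iUnion.2 ⟨∅, ?_⟩) hz
  have : flipOn ∅ x = x := by simp [funext_iff, flipOn]
  rwa [mem_preimage, this]

/-- A set of positive measure is not covered by fewer than `cov(N)` null sets, provided that
`cov(N)` is uncountable. -/
theorem not_subset_sUnion_of_mk_lt_covNull (hω : Cardinal.aleph0 < covNull)
    {E : Set CantorSpace} (hE : MeasurableSet E) (h0 : cantorMeasure E ≠ 0)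
    {𝒜 : Set (Set CantorSpace)} (h𝒜 : ∀ A ∈ 𝒜, cantorMeasure A = 0)
    (hcard : Cardinal.mk 𝒜 < covNull) : ¬ E ⊆ ⋃₀ 𝒜 := by
  intro hsub
  have hTm : MeasurableSet (⋃ s, flipOn s ⁻¹' E) :=
    MeasurableSet.iUnion fun s => (measurePreserving_flipOn s).measurable hE
  -- If `E` were covered, all flips of the covering sets, with the null complement of the saturation
  -- of `E`, would cover `2^ω`.
  set ℬ : Set (Set CantorSpace) :=
    insert (⋃ s, flipOn s ⁻¹' E)ᶜ (range fun p : Finset ℕ × 𝒜 => flipOn p.1 ⁻¹' p.2.1)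
  have hℬ : Cardinal.mk ℬ < covNull := by
    refine (Cardinal.mk_insert_le).trans_lt (Cardinal.add_lt_of_lt hω.le ?_
      (Cardinal.one_lt_aleph0.trans hω))
    refine Cardinal.mk_range_le.trans_lt ?_
    rw [Cardinal.mk_prod, Cardinal.lift_id, Cardinal.lift_id]
    exact Cardinal.mul_lt_of_lt hω.le (Cardinal.mk_le_aleph0.trans_lt hω) hcard
  refine notMem_of_lt_csInf' hℬ ⟨ℬ, ?_, ?_, rfl⟩
  · rintro A (rfl | ⟨⟨s, A, hA⟩, rfl⟩)
    · rw [prob_compl_eq_zero_iff hTm]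
      exact cantorMeasure_iUnion_flipOn hE h0
    · exact (measurePreserving_flipOn s).quasiMeasurePreserving.preimage_null (h𝒜 A hA)
  · refine eq_univ_of_forall fun x => ?_
    by_cases hx : x ∈ ⋃ s, flipOn s ⁻¹' E
    · obtain ⟨s, hs⟩ := mem_iUnion.1 hx
      obtain ⟨A, hA, hxA⟩ := hsub hs
      exact ⟨_, mem_insert_of_mem _ ⟨(s, ⟨A, hA⟩), rfl⟩, hxA⟩
    · exact ⟨_, mem_insert _ _, hx⟩

/-! ### The transfinite construction -/

/-- Construction of a sequence by well-founded recursion, from a requirement on each term which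
depends only on the previous terms. -/
theorem exists_forall_of_forall_exists {I S : Type*} [LT I] [WellFoundedLT I] [Nonempty S]
    (R : I → (I → S) → S → Prop)
    (hcongr : ∀ i s s' v, (∀ j < i, s j = s' j) → R i s v → R i s' v)
    (hex : ∀ i s, ∃ v, R i s v) : ∃ s : I → S, ∀ i, R i s (s i) := by
  classical
  choose f hf using hex
  let step : ∀ i : I, (∀ j, j < i → S) → S := fun i prev =>
    f i fun j => if h : j < i then prev j h else Classical.arbitrary S
  have hwf : WellFounded ((· < ·) : I → I → Prop) := wellFounded_lt
  refine ⟨hwf.fix step, fun i => ?_⟩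
  rw [hwf.fix_eq]
  exact hcongr i _ _ _ (fun j hj => by simp only [hj, dif_pos]) (hf i _)

theorem mk_of_isCantorCopy {P : Set CantorSpace} (hP : IsCantorCopy P) :
    Cardinal.mk P = Cardinal.continuum := by
  obtain ⟨h⟩ := hP
  rw [Cardinal.mk_congr h.toEquiv]
  simp

theorem measurableSet_of_isCantorCopy {P : Set CantorSpace} (hP : IsCantorCopy P) :
    MeasurableSet P := by
  obtain ⟨h⟩ := hP
  have : CompactSpace P := h.symm.compactSpace
  exact (isCompact_iff_compactSpace.2 this).isClosed.measurableSet

theorem mk_measurableSet_cantorSpace :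
    Cardinal.mk {A : Set CantorSpace // MeasurableSet A} ≤ Cardinal.continuum := by
  obtain ⟨b, hbc, hb⟩ :=
    MeasurableSpace.CountablyGenerated.isCountablyGenerated (α := CantorSpace)
  have := MeasurableSpace.cardinal_measurableSet_le_continuum
    ((Cardinal.mk_le_aleph0_iff.2 hbc.to_subtype).trans Cardinal.aleph0_le_continuum)
  rw [← hb] at this
  exact this

/-- One step of the construction: the points of the fibre over `y` outside a given set, avoiding
few points and belonging to few given sets with conull sections. -/
theorem exists_interleave_mem (hcov : covNull = Cardinal.continuum) (y : CantorSpace)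
    {G : Set CantorSpace} (hG : MeasurableSet G) {J : Type}
    (hJ : Cardinal.mk J < Cardinal.continuum) (F : J → Set CantorSpace)
    (hF : ∀ j, HasFullSections (F j)) (q : J → CantorSpace) (p : CantorSpace) :
    ∃ z, (∀ j, interleave y z ∈ F j) ∧ (∀ j, interleave y z ≠ q j) ∧ interleave y z ≠ p ∧
      (cantorMeasure (interleave y ⁻¹' G)ᶜ ≠ 0 → interleave y z ∉ G) := by
  have hω : Cardinal.aleph0 < covNull := hcov ▸ Cardinal.aleph0_lt_continuum
  have hpt : ∀ a, cantorMeasure (interleave y ⁻¹' {a}) = 0 := by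
    intro a
    have hs : (interleave y ⁻¹' {a}).Subsingleton :=
      subsingleton_singleton.preimage (interleave_injective_right y)
    rcases hs.eq_empty_or_singleton with h | ⟨z, h⟩
    · rw [h, measure_empty]
    · rw [h, cantorMeasure_singleton]
  obtain ⟨E, hE, hE0, hEG⟩ : ∃ E : Set CantorSpace, MeasurableSet E ∧ cantorMeasure E ≠ 0 ∧
      (cantorMeasure (interleave y ⁻¹' G)ᶜ ≠ 0 → ∀ z ∈ E, interleave y z ∉ G) := by
    by_cases h : cantorMeasure (interleave y ⁻¹' G)ᶜ = 0
    · exact ⟨univ, MeasurableSet.univ, by simp, fun h' => absurd h h'⟩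
    · exact ⟨_, ((continuous_interleave_right y).measurable hG).compl, h, fun _ z hz => hz⟩
  set 𝒜 : Set (Set CantorSpace) := insert (interleave y ⁻¹' {p})
    ((range fun j => (interleave y ⁻¹' F j)ᶜ) ∪ range fun j => interleave y ⁻¹' {q j})
  have h𝒜 : ∀ A ∈ 𝒜, cantorMeasure A = 0 := by
    rintro A (rfl | ⟨j, rfl⟩ | ⟨j, rfl⟩)
    exacts [hpt p, hF j y, hpt (q j)]
  have hcard : Cardinal.mk 𝒜 < covNull := by
    rw [← hcov] at hJ
    refine Cardinal.mk_insert_le.trans_lt (Cardinal.add_lt_of_lt hω.le ?_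
      (Cardinal.one_lt_aleph0.trans hω))
    exact (Cardinal.mk_union_le _ _).trans_lt (Cardinal.add_lt_of_lt hω.le
      (Cardinal.mk_range_le.trans_lt hJ) (Cardinal.mk_range_le.trans_lt hJ))
  obtain ⟨z, hzE, hz⟩ := not_subset.1 (not_subset_sUnion_of_mk_lt_covNull hω hE hE0 h𝒜 hcard)
  refine ⟨z, fun j => ?_, fun j h => ?_, fun h => ?_, fun h => hEG h z hzE⟩
  · by_contra h
    exact hz ⟨_, mem_insert_of_mem _ (Or.inl ⟨j, rfl⟩), h⟩
  · exact hz ⟨_, mem_insert_of_mem _ (Or.inr ⟨j, rfl⟩), h⟩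
  · exact hz ⟨_, mem_insert _ _, h⟩

/-- A set of tasks of size `𝔠` can be arranged so that each task has fewer than `𝔠` predecessors. -/
theorem exists_equiv_wellOrder_mk_Iic_lt {T : Type} (hT : Cardinal.mk T = Cardinal.continuum) :
    ∃ (I : Type) (_ : LinearOrder I) (_ : WellFoundedLT I) (_ : I ≃ T),
      ∀ i : I, Cardinal.mk (Iic i) < Cardinal.continuum := by
  obtain ⟨hlo, hwf, hord⟩ := Cardinal.exists_ord_eq_type_lt T
  exact ⟨T, hlo, hwf, Equiv.refl T, fun i =>
    hT ▸ Cardinal.mk_Iic_lt i hord (hT ▸ Cardinal.aleph0_le_continuum)⟩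

/-- Under `cov(N) = 𝔠` there is a set without perfect subsets, projecting onto the Cantor space,
which inside every `G_δ` superset is concentrated on a `σ`-compact set, up to fewer than `𝔠`
points. -/
theorem exists_totallyImperfect_concentrated (hcov : covNull = Cardinal.continuum) :
    ∃ X : Set CantorSpace, (∀ y, ∃ z, interleave y z ∈ X) ∧ IsTotallyImperfect X ∧
      ∀ U : ℕ → Set CantorSpace, (∀ n, IsOpen (U n)) → X ⊆ ⋂ n, U n →
        ∃ C : ℕ → Set CantorSpace, (∀ k, IsCompact (C k)) ∧ (⋃ k, C k) ⊆ ⋂ n, U n ∧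
          Cardinal.mk ↥(X \ ⋃ k, C k) < Cardinal.continuum := by
  -- The default `F = univ` for irrelevant `G` makes the demand on later points harmless.
  have hFs : ∀ G : Set CantorSpace, ∃ F, HasFullSections F ∧
      ∀ U : ℕ → Set CantorSpace, (∀ n, IsOpen (U n)) → G = ⋂ n, U n → HasFullSections G →
        ∃ C : ℕ → Set CantorSpace, (∀ k, IsCompact (C k)) ∧ F = ⋃ k, C k ∧ F ⊆ G := by
    intro G
    by_cases h : (∃ U : ℕ → Set CantorSpace, (∀ n, IsOpen (U n)) ∧ G = ⋂ n, U n) ∧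
        HasFullSections G
    · obtain ⟨⟨U, hU, rfl⟩, hG⟩ := h
      obtain ⟨C, hC, hCU, hCf⟩ := exists_iUnion_isCompact_subset_of_hasFullSections hU hG
      exact ⟨_, hCf, fun _ _ _ _ => ⟨C, hC, rfl, hCU⟩⟩
    · exact ⟨univ, fun y => by simp, fun U hU hG hf => absurd ⟨⟨U, hU, hG⟩, hf⟩ h⟩
  choose Fs hFull hFs using hFs
  let T := CantorSpace × {A : Set CantorSpace // MeasurableSet A} ×
    {A : Set CantorSpace // MeasurableSet A}
  have hT : Cardinal.mk T = Cardinal.continuum := by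
    have h1 : Cardinal.mk CantorSpace = Cardinal.continuum := by simp
    refine le_antisymm ?_ ?_
    · simp only [T, Cardinal.mk_prod, Cardinal.lift_id, h1]
      refine (mul_le_mul' le_rfl (mul_le_mul' mk_measurableSet_cantorSpace
        mk_measurableSet_cantorSpace)).trans ?_
      simp
    · rw [← h1]
      exact Cardinal.mk_le_of_injective
        (f := fun y => ((y, ⟨∅, .empty⟩, ⟨∅, .empty⟩) : T)) fun a b h => congrArg Prod.fst h
  obtain ⟨I, _, _, e, hle⟩ := exists_equiv_wellOrder_mk_Iic_lt hT
  have hlt : ∀ i : I, Cardinal.mk (Iio i) < Cardinal.continuum := fun i =>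
    (Cardinal.mk_le_mk_of_subset Iio_subset_Iic_self).trans_lt (hle i)
  -- The first component is the point put into X, the second the point reserved outside X.
  obtain ⟨s, hs⟩ := exists_forall_of_forall_exists (I := I) (S := CantorSpace × CantorSpace)
    (fun i s v => (IsCantorCopy (e i).2.2.1 → v.2 ∈ (e i).2.2.1 ∧ ∀ j < i, v.2 ≠ (s j).1) ∧
      (∃ z, v.1 = interleave (e i).1 z) ∧ (∀ j < i, v.1 ∈ Fs (e j).2.1.1) ∧
      (∀ j < i, v.1 ≠ (s j).2) ∧ v.1 ≠ v.2 ∧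
      (cantorMeasure (interleave (e i).1 ⁻¹' (e i).2.1.1)ᶜ ≠ 0 → v.1 ∉ (e i).2.1.1))
    (by
      rintro i s s' v h ⟨h1, h2, h3, h4, h5⟩
      exact ⟨fun hP => ⟨(h1 hP).1, fun j hj => h j hj ▸ (h1 hP).2 j hj⟩, h2, h3,
        fun j hj => h j hj ▸ h4 j hj, h5⟩)
    (by
      intro i s
      obtain ⟨p, hp⟩ : ∃ p, IsCantorCopy (e i).2.2.1 → p ∈ (e i).2.2.1 ∧ ∀ j < i, p ≠ (s j).1 := by
        by_cases hP : IsCantorCopy (e i).2.2.1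
        · have : ¬ (e i).2.2.1 ⊆ (fun j => (s j).1) '' Iio i := fun hsub =>
            ((Cardinal.mk_le_mk_of_subset hsub).trans Cardinal.mk_image_le).not_gt
              (by rw [mk_of_isCantorCopy hP]; exact hlt i)
          obtain ⟨p, hp, hp'⟩ := not_subset.1 this
          exact ⟨p, fun _ => ⟨hp, fun j hj h => hp' ⟨j, hj, h.symm⟩⟩⟩
        · exact ⟨(e i).1, fun h => absurd h hP⟩
      obtain ⟨z, h1, h2, h3, h4⟩ := exists_interleave_mem hcov (e i).1 (e i).2.1.2 (hlt i)
        (fun j => Fs (e j.1).2.1.1) (fun j => hFull _) (fun j => (s j.1).2) p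
      exact ⟨(interleave (e i).1 z, p), hp, ⟨z, rfl⟩, fun j hj => h1 ⟨j, hj⟩,
        fun j hj => h2 ⟨j, hj⟩, h3, h4⟩)
  refine ⟨range fun i => (s i).1, fun y => ?_, fun P hP hsub => ?_, fun U hU hXU => ?_⟩
  · obtain ⟨i, hi⟩ := e.surjective (y, ⟨∅, .empty⟩, ⟨∅, .empty⟩)
    obtain ⟨-, ⟨z, hz⟩, -⟩ := hs i
    rw [hi] at hz
    exact ⟨z, i, hz⟩
  · obtain ⟨i, hei⟩ := e.surjective
      (fun _ => false, ⟨∅, .empty⟩, ⟨P, measurableSet_of_isCantorCopy hP⟩)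
    obtain ⟨hi, -, -, -, hne, -⟩ := hs i
    rw [hei] at hi
    obtain ⟨hpP, hp⟩ := hi hP
    obtain ⟨j, hj⟩ := hsub hpP
    -- The reserved point differs from points chosen earlier, at the same stage and later, each by a
    -- separate clause.
    rcases lt_trichotomy j i with h | h | h
    · exact hp j h hj.symm
    · subst h
      exact hne hj
    · exact (hs j).2.2.2.1 i h hj
  · have hGm : MeasurableSet (⋂ n, U n) := MeasurableSet.iInter fun n => (hU n).measurableSet
    have hfull : HasFullSections (⋂ n, U n) := by
      intro y
      by_contra h
      obtain ⟨i, hi⟩ := e.surjective (y, ⟨_, hGm⟩, ⟨∅, .empty⟩)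
      have := (hs i).2.2.2.2.2
      rw [hi] at this
      exact this h (hXU ⟨i, rfl⟩)
    obtain ⟨C, hC, hFC, hCU⟩ := hFs _ U hU rfl hfull
    refine ⟨C, hC, hFC ▸ hCU, ?_⟩
    obtain ⟨i, hi⟩ := e.surjective (fun _ => false, ⟨_, hGm⟩, ⟨∅, .empty⟩)
    have hsub : (range fun i => (s i).1) \ ⋃ k, C k ⊆ (fun j => (s j).1) '' Iic i := by
      rintro _ ⟨⟨j, rfl⟩, hj⟩
      refine ⟨j, ?_, rfl⟩
      by_contra hji
      have := (hs j).2.2.1 i (not_le.1 hji)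
      rw [hi] at this
      exact hj (hFC ▸ this)
    exact ((Cardinal.mk_le_mk_of_subset hsub).trans Cardinal.mk_image_le).trans_lt (hle i)

/-! ### The Hurewicz property -/

/-- Fewer than `𝔟` functions are eventually dominated by one function. -/
theorem exists_dominating_of_mk_lt {ι : Type} (f : ι → ℕ → ℕ)
    (h : Cardinal.mk ι < boundingNumber) : ∃ g : ℕ → ℕ, ∀ i, ∀ᶠ n in atTop, f i n ≤ g n := by
  have h' : Cardinal.mk (range f) < boundingNumber := Cardinal.mk_range_le.trans_lt h
  by_contra hg
  refine notMem_of_lt_csInf' h' ⟨range f, fun ⟨g, hgf⟩ => hg ⟨g, fun i => hgf _ ⟨i, rfl⟩⟩, rfl⟩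

/-- Sets of size less than `𝔟` have the Hurewicz covering property. -/
theorem isHurewicz_of_mk_lt {α : Type} [TopologicalSpace α] [SecondCountableTopology α]
    {S : Set α} (h : Cardinal.mk S < boundingNumber) : IsHurewicz S := by
  intro 𝒰 h𝒰
  choose 𝒱 h𝒱c h𝒱 h𝒱U using fun n =>
    TopologicalSpace.isOpen_sUnion_countable (𝒰 n) (h𝒰 n).1
  rcases S.eq_empty_or_nonempty with rfl | ⟨a, ha⟩
  · exact ⟨fun _ => ∅, fun n => ⟨empty_subset _, finite_empty⟩, fun x hx => hx.elim⟩
  have hcover : ∀ n, S ⊆ ⋃₀ 𝒱 n := fun n => h𝒱U n ▸ (h𝒰 n).2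
  have hne : ∀ n, (𝒱 n).Nonempty := fun n => (hcover n ha).imp fun _ => And.left
  choose u hu using fun n => (h𝒱c n).exists_eq_range (hne n)
  have key : ∀ (x : S) (n : ℕ), ∃ k, x.1 ∈ u n k := by
    intro x n
    obtain ⟨V, hV, hx⟩ := hcover n x.2
    obtain ⟨k, rfl⟩ := hu n ▸ hV
    exact ⟨k, hx⟩
  choose f hf using key
  obtain ⟨g, hg⟩ := exists_dominating_of_mk_lt f h
  refine ⟨fun n => u n '' Iic (g n), fun n => ⟨?_, (finite_Iic _).image _⟩, fun x hx => ?_⟩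
  · rintro _ ⟨k, -, rfl⟩
    exact h𝒱 n (hu n ▸ mem_range_self k)
  · filter_upwards [hg ⟨x, hx⟩] with n hn
    exact ⟨_, ⟨_, hn, rfl⟩, hf ⟨x, hx⟩ n⟩

/-- A set which inside every `G_δ` superset is concentrated, up to fewer than `𝔟` points, on a
`σ`-compact set has the Hurewicz covering property. -/
theorem isHurewicz_of_concentrated {α : Type} [TopologicalSpace α] [SecondCountableTopology α]
    {X : Set α}
    (h : ∀ U : ℕ → Set α, (∀ n, IsOpen (U n)) → X ⊆ ⋂ n, U n →
      ∃ C : ℕ → Set α, (∀ k, IsCompact (C k)) ∧ (⋃ k, C k) ⊆ ⋂ n, U n ∧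
        Cardinal.mk ↥(X \ ⋃ k, C k) < boundingNumber) : IsHurewicz X := by
  intro 𝒰 h𝒰
  obtain ⟨C, hC, hCU, hcard⟩ := h (fun n => ⋃₀ 𝒰 n) (fun n => isOpen_sUnion (h𝒰 n).1)
    (subset_iInter fun n => (h𝒰 n).2)
  obtain ⟨ℱ, hℱ, hℱX⟩ := isHurewicz_of_mk_lt hcard 𝒰
    fun n => ⟨(h𝒰 n).1, sdiff_subset.trans (h𝒰 n).2⟩
  -- Covering the first `n + 1` compact sets at step `n` catches each `C k` from step `k` on.
  have key : ∀ n, ∃ 𝒢 ⊆ 𝒰 n, 𝒢.Finite ∧ ∀ k ≤ n, C k ⊆ ⋃₀ 𝒢 := by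
    intro n
    obtain ⟨t, ht⟩ := ((finite_Iic n).isCompact_biUnion fun k _ => hC k).elim_finite_subcover
      (fun V : 𝒰 n => V.1) (fun V => (h𝒰 n).1 _ V.2) (by
        rw [← sUnion_eq_iUnion]
        exact iUnion₂_subset fun k _ =>
          (subset_iUnion C k).trans (hCU.trans (iInter_subset _ n)))
    refine ⟨Subtype.val '' (t : Set (𝒰 n)), ?_, t.finite_toSet.image _, fun k hk x hx => ?_⟩
    · rintro _ ⟨V, -, rfl⟩
      exact V.2
    · obtain ⟨V, hV, hxV⟩ := mem_iUnion₂.1 (ht (mem_biUnion (mem_Iic.2 hk) hx))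
      exact ⟨V.1, ⟨V, hV, rfl⟩, hxV⟩
  choose 𝒢 h𝒢U h𝒢f h𝒢 using key
  refine ⟨fun n => ℱ n ∪ 𝒢 n, fun n => ⟨union_subset (hℱ n).1 (h𝒢U n),
    (hℱ n).2.union (h𝒢f n)⟩, fun x hx => ?_⟩
  by_cases hxC : x ∈ ⋃ k, C k
  · obtain ⟨k, hk⟩ := mem_iUnion.1 hxC
    filter_upwards [eventually_ge_atTop k] with n hn
    exact sUnion_mono subset_union_right (h𝒢 n k hn hk)
  · filter_upwards [hℱX x ⟨hx, hxC⟩] with n hn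
    exact sUnion_mono subset_union_left hn

/-! ### Meagerness in perfect sets and in projections -/

/-- A Hurewicz set is separated from a disjoint countable set by an `F_σ`-set. -/
theorem IsHurewicz.exists_isFSigmaSet_superset {X : Set CantorSpace} (hX : IsHurewicz X)
    {D : Set CantorSpace} (hD : D.Countable) (hXD : Disjoint X D) :
    ∃ F, IsFSigmaSet F ∧ X ⊆ F ∧ Disjoint F D := by
  rcases D.eq_empty_or_nonempty with rfl | hne
  · exact ⟨univ, ⟨fun _ => univ, fun _ => isClosed_univ, (iUnion_const _).symm⟩, subset_univ _,
      disjoint_empty _⟩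
  obtain ⟨d, rfl⟩ := hD.exists_eq_range hne
  have hcl : ∀ x k, IsClosed (PiNat.cylinder x k : Set CantorSpace) := by
    intro x k
    rw [PiNat.cylinder_eq_pi]
    exact isClosed_set_pi fun _ _ => isClosed_discrete _
  -- Each point of `D` is listed infinitely often, so it is missed by some set in every tail
  -- intersection.
  let e : ℕ → CantorSpace := fun n => d n.unpair.1
  obtain ⟨ℱ, hℱ, hℱX⟩ := hX (fun n => range fun k => (PiNat.cylinder (e n) k)ᶜ) (by
    refine fun n => ⟨?_, fun x hx => ?_⟩
    · rintro _ ⟨k, rfl⟩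
      exact (hcl _ _).isOpen_compl
    · have hne : e n ≠ x := fun h => hXD.le_bot ⟨hx, ⟨_, h⟩⟩
      obtain ⟨k, hk⟩ := Function.ne_iff.1 hne
      refine ⟨_, ⟨k + 1, rfl⟩, fun hx' => hk ?_⟩
      exact (hx' k (Nat.lt_succ_self k)).symm)
  have hopen : ∀ n, IsOpen (⋂₀ (compl '' ℱ n)) := by
    intro n
    refine ((hℱ n).2.image _).isOpen_sInter ?_
    rintro _ ⟨A, hA, rfl⟩
    obtain ⟨k, rfl⟩ := (hℱ n).1 hA
    rw [compl_compl]
    exact PiNat.isOpen_cylinder _ _ _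
  refine ⟨⋃ m, ⋂ n ≥ m, ⋃₀ ℱ n, ⟨_, fun m => isClosed_biInter fun n _ => ?_, rfl⟩,
    fun x hx => ?_, ?_⟩
  · rw [← isOpen_compl_iff, compl_sUnion]
    exact hopen n
  · obtain ⟨m, hm⟩ := eventually_atTop.1 (hℱX x hx)
    exact mem_iUnion.2 ⟨m, mem_iInter₂.2 hm⟩
  · rw [disjoint_left]
    rintro x hxF ⟨j, rfl⟩
    obtain ⟨m, hm⟩ := mem_iUnion.1 hxF
    obtain ⟨A, hA, hjA⟩ := mem_iInter₂.1 hm (Nat.pair j m) (Nat.right_le_pair j m)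
    obtain ⟨k, rfl⟩ := (hℱ _).1 hA
    refine hjA ?_
    simp only [e, Nat.unpair_pair]
    exact PiNat.self_mem_cylinder _ _

/-- The cylinder of length `n` around `x` is homeomorphic to the Cantor space. -/
def cylinderHomeomorph (x : CantorSpace) (n : ℕ) :
    (PiNat.cylinder x n : Set CantorSpace) ≃ₜ CantorSpace where
  toFun y i := y.1 (i + n)
  invFun z := ⟨fun i => if i < n then x i else z (i - n), fun i hi => by simp [hi]⟩
  left_inv y := by
    ext i
    by_cases hi : i < n
    · simp [hi, y.2 i hi]
    · simp [hi, Nat.sub_add_cancel (not_lt.1 hi)]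
  right_inv z := by
    funext i
    simp
  continuous_toFun := continuous_pi fun i => (continuous_apply (i + n)).comp continuous_subtype_val
  continuous_invFun := by
    refine Continuous.subtype_mk (continuous_pi fun i => ?_) _
    by_cases hi : i < n <;> simp only [hi, if_true, if_false] <;> fun_prop

/-- Every nonempty relatively open subset of a perfect set contains a perfect set. -/
theorem IsCantorCopy.exists_subset {α : Type*} [TopologicalSpace α] {P : Set α}
    (hP : IsCantorCopy P) {V : Set P} (hV : IsOpen V) (hne : V.Nonempty) :
    ∃ Q : Set α, IsCantorCopy Q ∧ Q ⊆ Subtype.val '' V := by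
  obtain ⟨h⟩ := hP
  obtain ⟨p, hp⟩ := hne
  obtain ⟨_, ⟨x, n, rfl⟩, -, hxV⟩ :=
    (PiNat.isTopologicalBasis_cylinders (fun _ : ℕ => Bool)).exists_subset_of_mem_open
      (show h p ∈ h.symm ⁻¹' V by simpa using hp) (hV.preimage h.symm.continuous)
  have hemb : IsEmbedding fun z : CantorSpace =>
      (h.symm ((cylinderHomeomorph x n).symm z).1 : α) :=
    IsEmbedding.subtypeVal.comp (h.symm.isEmbedding.comp
      (IsEmbedding.subtypeVal.comp (cylinderHomeomorph x n).symm.isEmbedding))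
  refine ⟨range fun z : CantorSpace => (h.symm ((cylinderHomeomorph x n).symm z).1 : α),
    ⟨hemb.toHomeomorph.symm⟩, ?_⟩
  rintro _ ⟨z, rfl⟩
  exact ⟨_, hxV ((cylinderHomeomorph x n).symm z).2, rfl⟩

/-- Totally imperfect Hurewicz sets are countably perfectly meager. -/
theorem IsHurewicz.isCountablyPerfectlyMeager {X : Set CantorSpace} (hX : IsHurewicz X)
    (hXi : IsTotallyImperfect X) : IsCountablyPerfectlyMeager X := by
  intro P hP
  have key : ∀ n, ∃ D : Set (P n), D.Countable ∧ Dense D ∧ ∀ p ∈ D, p.1 ∉ X := by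
    intro n
    -- Otherwise X would contain a nonempty relatively open piece of `P n`, hence a perfect set.
    have hdense : Dense {p : P n | p.1 ∉ X} := by
      rw [dense_iff_inter_open]
      intro V hV hne
      obtain ⟨Q, hQ, hQV⟩ := (hP n).exists_subset hV hne
      obtain ⟨q, hq, hqX⟩ := not_subset.1 (hXi Q hQ)
      obtain ⟨p, hp, rfl⟩ := hQV hq
      exact ⟨p, hp, hqX⟩
    obtain ⟨D, hDX, hDc, hD⟩ := hdense.exists_countable_dense_subset
    exact ⟨D, hDc, hD, fun p hp => hDX hp⟩
  choose D hDc hD hDX using key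
  obtain ⟨F, ⟨C, hC, rfl⟩, hXF, hFD⟩ := hX.exists_isFSigmaSet_superset
    (D := ⋃ n, Subtype.val '' D n) (countable_iUnion fun n => (hDc n).image _) (by
      rw [disjoint_left]
      intro x hx hxD
      obtain ⟨n, p, hp, rfl⟩ := mem_iUnion.1 hxD
      exact hDX n p hp hx)
  refine ⟨_, ⟨C, hC, rfl⟩, hXF, fun n => ?_⟩
  rw [preimage_iUnion]
  refine isMeagre_iUnion fun m => IsNowhereDense.isMeagre ?_
  have hcl : IsClosed ((Subtype.val : P n → CantorSpace) ⁻¹' C m) :=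
    (hC m).preimage continuous_subtype_val
  rw [hcl.isNowhereDense_iff, interior_eq_empty_iff_dense_compl]
  refine (hD n).mono fun p hp hpC => ?_
  exact disjoint_left.1 hFD (mem_iUnion.2 ⟨m, hpC⟩) (mem_iUnion.2 ⟨n, p, hp, rfl⟩)

/-- A set whose even parts are all points of the Cantor space is not everywhere meager. -/
theorem not_isEverywhereMeager_of_forall_interleave_mem {X : Set CantorSpace}
    (hX : ∀ y, ∃ z, interleave y z ∈ X) : ¬ IsEverywhereMeager X := by
  intro h
  have hm := h (range fun n => 2 * n)
    (infinite_range_of_injective fun a b hab => by simpa using hab)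
  have huniv : (fun (x : CantorSpace) (i : range fun n : ℕ => 2 * n) => x i) '' X = univ := by
    refine eq_univ_of_forall fun w => ?_
    obtain ⟨z, hz⟩ := hX fun n => w ⟨2 * n, n, rfl⟩
    refine ⟨_, hz, ?_⟩
    funext ⟨_, n, rfl⟩
    exact interleave_even _ _ _
  rw [huniv] at hm
  exact not_isMeagre_of_isOpen isOpen_univ univ_nonempty hm

theorem mainTheorem5 (hcov : covNull = Cardinal.continuum)
    (hb : boundingNumber = Cardinal.continuum) :
    ∃ X : Set CantorSpace,
      IsTotallyImperfect X ∧ IsHurewicz X ∧ IsCountablyPerfectlyMeager X ∧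
        ¬ IsEverywhereMeager X := by
  obtain ⟨X, hproj, hXi, hXc⟩ := exists_totallyImperfect_concentrated hcov
  have hX : IsHurewicz X := isHurewicz_of_concentrated (hb ▸ hXc)
  exact ⟨X, hXi, hX, hX.isCountablyPerfectlyMeager hXi,
    not_isEverywhereMeager_of_forall_interleave_mem hproj⟩
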